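/- Consider the quadratic vector field $v_\lambda(z)=\mu z+Az^2+Bz\bar z+C\bar z^2$ on $\mathbb C=\mathbb R^2$, where $\mu=\lambda_1+i$, $\lambda_1\ge 0$, $A,B,C\in\mathbb C$, and suppose that it is \emph{normalized}: $|A|\le 1$, $|B|\le 2$, $|C|\le 1$, and at least one of $A=1$, $B=2$, $C=1$ holds. Write $v_\lambda=v_s+u$, where $v_s(z)=\mu z\,(az+\bar a\bar z+1)$ with $a=A/\mu$, and $u=bz\bar z+c\bar z^2$ with $b=B-\frac{\mu}{\bar\mu}\bar A$, $c=C$. Let $\kappa>0$ and suppose that $v_\lambda$ is $\kappa$-\emph{distant from singular quadratic vector fields}, i.e. $\sqrt{|b|^2+|c|^2}>\kappa$. (For $A=1$ one has $b=B-\mu/\bar\mu$; if $\kappa<1$, every normalized field with $A\ne 1$ satisfies the condition.) For $0<\delta<1$ let $B(\lambda,\delta)$ be the disc $|z|\le\delta^{-1}$ minus the open $\delta$-neighbourhoods in $\mathbb C^2$ of all singular points of $v_\lambda$ other than $0$, both real and complex (a complex singular point is a common zero in $\mathbb C^2\supset\mathbb R^2$ of the two real polynomial components of $v_\lambda$). A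 limit cycle (isolated closed orbit) of $v_\lambda$ is $\delta$-\emph{tame} if it is contained in $B(\lambda,\delta)$. In polar coordinates $z=re^{i\theta}$, $r\ge 0$, one has $\dot\theta=1+rg_\lambda(\theta)$ with $$g_\lambda(\theta)=\operatorname{Im}\left(Ae^{i\theta}+Be^{-i\theta}+Ce^{-3i\theta}\right).$$ Lemma (Second Main Lemma). Under these assumptions, no $\delta$-tame limit cycle of $v_\lambda$ that surrounds the origin meets the curvilinear strip $$\Pi_\beta=\left\{re^{i\theta}\in B(\lambda,\delta)\ :\ r\ge 0,\ g_\lambda(\theta)\neq 0,\ -\frac1{g_\lambda(\theta)}-\beta\le r\le-\frac1{g_\lambda(\theta)}\right\},\qquad \beta=\frac{\delta^{14}\kappa}{10^{10}}.$$ -/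

import Mathlib

open scoped ComplexConjugate

noncomputable section

/-- Parameters `(l₁, A, B, C)` of a planar quadratic field `z' = (l₁ + i) z + A z² + B z z̄ + C z̄²`. -/
structure QuadParam where
  l₁ : ℝ
  A : ℂ
  B : ℂ
  C : ℂ

namespace QuadParam

/-- The linear coefficient `μ = l₁ + i`. -/
def mu (p : QuadParam) : ℂ := (p.l₁ : ℂ) + Complex.I

/-- The quadratic vector field on the plane `ℂ = ℝ²`. -/
def field (p : QuadParam) (z : ℂ) : ℂ :=
  p.mu * z + p.A * z ^ 2 + p.B * (z * conj z) + p.C * (conj z) ^ 2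

/-- Normalized parameters: `l₁ ≥ 0`, and `(A, B, C)` lies in the polydisc `|A| ≤ 1, |B| ≤ 2, |C| ≤ 1`
with `A = 1`, or `B = 2`, or `C = 1`. -/
def IsNormalized (p : QuadParam) : Prop :=
  0 ≤ p.l₁ ∧
    ((p.A = 1 ∧ ‖p.B‖ ≤ 2 ∧ ‖p.C‖ ≤ 1) ∨
     (p.B = 2 ∧ ‖p.A‖ ≤ 1 ∧ ‖p.C‖ ≤ 1) ∨
     (p.C = 1 ∧ ‖p.A‖ ≤ 1 ∧ ‖p.B‖ ≤ 2))

/-- `(x, y) ∈ ℂ²` is a singular point of the complexified field. With `ζ = x + i y`, `η = x - i y`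
(which are `z` and `z̄` when `x, y` are real), the two equations say that the polynomial
components of the field, continued to `ℂ²`, both vanish at `(x, y)`. -/
def IsSingularPoint (p : QuadParam) (x y : ℂ) : Prop :=
  p.mu * (x + Complex.I * y) + p.A * (x + Complex.I * y) ^ 2
      + p.B * ((x + Complex.I * y) * (x - Complex.I * y)) + p.C * (x - Complex.I * y) ^ 2 = 0 ∧
    conj p.mu * (x - Complex.I * y) + conj p.A * (x - Complex.I * y) ^ 2
      + conj p.B * ((x + Complex.I * y) * (x - Complex.I * y))
      + conj p.C * (x + Complex.I * y) ^ 2 = 0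

/-- The real singular points of the complexified field are the zeros of the field. -/
theorem isSingularPoint_ofReal (p : QuadParam) (z : ℂ) :
    p.IsSingularPoint (z.re : ℂ) (z.im : ℂ) ↔ p.field z = 0 := by
  have h1 : (z.re : ℂ) + Complex.I * (z.im : ℂ) = z := by
    rw [mul_comm]; exact Complex.re_add_im z
  have h2 : (z.re : ℂ) - Complex.I * (z.im : ℂ) = conj z := by
    apply Complex.ext <;> simp
  have h3 : conj p.mu * conj z + conj p.A * (conj z) ^ 2 + conj p.B * (z * conj z)
      + conj p.C * z ^ 2 = conj (p.field z) := by
    simp only [field, map_add, map_mul, map_pow, Complex.conj_conj]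
    ring
  unfold IsSingularPoint
  rw [h1, h2, h3]
  constructor
  · intro h; exact h.1
  · intro h; exact ⟨h, by rw [h, map_zero]⟩

/-- `B(p, δ)`: the closed disc of radius `1/δ` minus the open `δ`-neighbourhoods (in `ℂ²`, with its
Hermitian distance) of all singular points, real and complex, other than the origin. -/
def tameDomain (p : QuadParam) (δ : ℝ) : Set ℂ :=
  {z | ‖z‖ ≤ δ⁻¹ ∧ ∀ x y : ℂ, p.IsSingularPoint x y → (x, y) ≠ (0, 0) →
    δ ≤ Real.sqrt (‖(z.re : ℂ) - x‖ ^ 2 + ‖(z.im : ℂ) - y‖ ^ 2)}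

/-- `h(θ) = A e^{iθ} + B e^{-iθ} + C e^{-3iθ}`. -/
def h (p : QuadParam) (θ : ℝ) : ℂ :=
  p.A * Complex.exp (Complex.I * θ) + p.B * Complex.exp (-(Complex.I * θ))
    + p.C * Complex.exp (-(3 * (Complex.I * θ)))

/-- `g = Im h`, so that `θ' = 1 + r g(θ)` in polar coordinates. -/
def g (p : QuadParam) (θ : ℝ) : ℝ := (p.h θ).im

/-- The polar form of the field: `v(z) / z = μ + r h(θ)` at `z = r e^{iθ}`. -/
theorem field_polar (p : QuadParam) (r θ : ℝ) :
    p.field (r * Complex.exp (Complex.I * θ))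
      = (r * Complex.exp (Complex.I * θ)) * (p.mu + r * p.h θ) := by
  have hc : conj (Complex.exp (Complex.I * θ)) = (Complex.exp (Complex.I * θ))⁻¹ := by
    rw [← Complex.exp_conj, ← Complex.exp_neg]; simp
  have h3 : Complex.exp (-(3 * (Complex.I * θ))) = ((Complex.exp (Complex.I * θ))⁻¹) ^ 3 := by
    rw [← Complex.exp_neg, ← Complex.exp_nat_mul]; congr 1; push_cast; ring
  have hne := Complex.exp_ne_zero (Complex.I * θ)
  simp only [field, h, map_mul, Complex.conj_ofReal, hc, h3, Complex.exp_neg]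
  field_simp
  ring

/-- The curvilinear strip `-1/g(θ) - β ≤ r ≤ -1/g(θ)` inside `B(p, δ)`, in polar coordinates. -/
def strip (p : QuadParam) (δ β : ℝ) : Set ℂ :=
  {z | z ∈ p.tameDomain δ ∧ ∃ r θ : ℝ, 0 ≤ r ∧ z = r * Complex.exp (Complex.I * θ) ∧
    p.g θ ≠ 0 ∧ -1 / p.g θ - β ≤ r ∧ r ≤ -1 / p.g θ}

/-- The singular field `μ z (a z + ā z̄ + 1)` with line of singular points `a z + ā z̄ + 1 = 0`. -/
def singularField (μ a : ℂ) (z : ℂ) : ℂ := μ * z * (a * z + conj a * conj z + 1)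

/-- The coefficient `b` of `z z̄` in the decomposition `v = v_s + b z z̄ + c z̄²`, where `v_s` is the
singular field with the same linear and `z²` terms as `v`. If `A = 1` then `b = B - μ / μ̄`. -/
def devB (p : QuadParam) : ℂ := p.B - p.mu / conj p.mu * conj p.A

theorem mu_ne_zero (p : QuadParam) : p.mu ≠ 0 := by
  intro h0
  have := congrArg Complex.im h0
  simp [mu] at this

/-- The decomposition `v = v_s + u`, `u = b z z̄ + c z̄²`. -/
theorem field_eq_singularField_add (p : QuadParam) (z : ℂ) :
    p.field z = singularField p.mu (p.A / p.mu) z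
      + (p.devB * (z * conj z) + p.C * (conj z) ^ 2) := by
  have h1 := p.mu_ne_zero
  have h2 : conj p.mu ≠ 0 := by simpa using h1
  simp only [field, singularField, devB, map_div₀]
  field_simp
  ring

/-- `κ`-distant from singular fields: `‖r⁻² u‖₂ = √(|b|² + |c|²) > κ`, with `c = C`. -/
def IsDistantFromSingular (p : QuadParam) (κ : ℝ) : Prop :=
  κ < Real.sqrt (‖p.devB‖ ^ 2 + ‖p.C‖ ^ 2)

theorem isDistantFromSingular_of_A_eq_one (p : QuadParam) (κ : ℝ) (hA : p.A = 1) :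
    p.IsDistantFromSingular κ ↔ κ < Real.sqrt (‖p.B - p.mu / conj p.mu‖ ^ 2 + ‖p.C‖ ^ 2) := by
  simp [IsDistantFromSingular, devB, hA]

/-- For `κ < 1`, the condition restricts only the normal form with `A = 1`: the two other normal
forms are always `κ`-distant from singular fields. -/
theorem isDistantFromSingular_of_A_ne_one (p : QuadParam) (κ : ℝ) (hp : p.IsNormalized)
    (hκ : κ < 1) (hA : p.A ≠ 1) : p.IsDistantFromSingular κ := by
  refine hκ.trans_le (Real.one_le_sqrt.mpr ?_)
  have hm : ‖p.mu / conj p.mu‖ = 1 := by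
    rw [norm_div, Complex.norm_conj, div_self (norm_ne_zero_iff.mpr p.mu_ne_zero)]
  rcases hp.2 with h1 | ⟨hB, h1, -⟩ | ⟨hC, -, -⟩
  · exact absurd h1.1 hA
  · have h2 : ‖p.B‖ - ‖p.mu / conj p.mu * conj p.A‖ ≤ ‖p.devB‖ := norm_sub_norm_le _ _
    rw [norm_mul, hm, Complex.norm_conj, hB] at h2
    norm_num at h2
    nlinarith [sq_nonneg ‖p.C‖]
  · rw [hC]; norm_num

end QuadParam

/-- `L` is a closed orbit of `v`: the image of a nonconstant periodic solution of `z' = v(z)`. -/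
def IsClosedOrbit (v : ℂ → ℂ) (L : Set ℂ) : Prop :=
  ∃ (γ : ℝ → ℂ) (T : ℝ), 0 < T ∧ (∀ t, HasDerivAt γ (v (γ t)) t) ∧ (∀ t, γ (t + T) = γ t) ∧
    (∃ t, γ t ≠ γ 0) ∧ Set.range γ = L

/-- A limit cycle: a closed orbit with a neighbourhood that contains no other closed orbit. -/
def IsLimitCycle (v : ℂ → ℂ) (L : Set ℂ) : Prop :=
  IsClosedOrbit v L ∧
    ∃ U : Set ℂ, IsOpen U ∧ L ⊆ U ∧ ∀ L' : Set ℂ, IsClosedOrbit v L' → L' ⊆ U → L' = L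

/-- `L` surrounds `z`: `z` lies in a bounded component of the complement of `L`. -/
def Surrounds (L : Set ℂ) (z : ℂ) : Prop :=
  z ∉ L ∧ Bornology.IsBounded (connectedComponentIn Lᶜ z)

/-- `L` is a `δ`-tame limit cycle of the field `p`. -/
def IsTameLimitCycle (p : QuadParam) (δ : ℝ) (L : Set ℂ) : Prop :=
  IsLimitCycle p.field L ∧ L ⊆ p.tameDomain δ

end

/-! ### Real analysis: level crossing and trapping for polar systems. -/

section

open Filter Topology Set

/-! Write E = v(z)/z = ρ + iθ' and w = θ' = 1 + r g(θ). Since |g| ≤ 4, points of the strip with r >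
0 have 0 ≤ w ≤ 4β, so it suffices that w > 4β along the cycle.

Transversality. E is bounded below at tame points with |z| ≥ 1/8 (`le_norm_logVel`). On a complex
line η = kζ, after division by ζ, the two components of the field give linear equations for ζ,
proportional exactly when k is a root of a cubic with coefficients of modulus |c|, |b|, |b|, |c|. At
a real point the slope k₀ = z̄/z is unimodular and the cubic is at most 2|E|/|z| there. If E is
small, a root near k₀ would give a singular point within δ of z, so all roots stay away from k₀; a
tiny E would then make the cubic small on the whole unit circle, against its ℓ² norm, which exceeds
κ. Hence where |w| ≤ 4β, ρ dominates w, and w' = ρ(w - 1) + r g'(θ) w is nonzero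
(`angular_accel_ne_zero`).

Positivity. Since g(θ + π) = -g(θ), some ray has θ' = 1; the cycle meets it and crosses it only
forwards, so the lifted angle is unbounded. If w vanished, the orbit would turn back and then forth
again, enclosing its own future between two of its arcs (`polar_trap`); so w > 0. The periodic
function w attains its minimum, where w' = 0, and transversality makes that minimum exceed 4β. -/

theorem HasDerivAt.eventually_lt_right {f : ℝ → ℝ} {f' x : ℝ} (hf : HasDerivAt f f' x)
    (h : 0 < f') : ∀ᶠ y in 𝓝[>] x, f x < f y := by
  have h1 := (hasDerivAt_iff_tendsto_slope.mp hf).eventually (lt_mem_nhds h)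
  have h2 : 𝓝[>] x ≤ 𝓝[≠] x := nhdsWithin_mono x fun y hy => ne_of_gt hy
  filter_upwards [h2 h1, self_mem_nhdsWithin] with y hy hxy
  exact (slope_pos_iff_of_le (le_of_lt hxy)).mp hy

theorem HasDerivAt.eventually_lt_left {f : ℝ → ℝ} {f' x : ℝ} (hf : HasDerivAt f f' x)
    (h : 0 < f') : ∀ᶠ y in 𝓝[<] x, f y < f x := by
  have h1 := (hasDerivAt_iff_tendsto_slope.mp hf).eventually (lt_mem_nhds h)
  have h2 : 𝓝[<] x ≤ 𝓝[≠] x := nhdsWithin_mono x fun y hy => ne_of_lt hy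
  filter_upwards [h2 h1, self_mem_nhdsWithin] with y hy hxy
  rw [slope_comm] at hy
  exact (slope_pos_iff_of_le (le_of_lt hxy)).mp hy

/-- The first time, from `a` on, at which a closed condition holds. -/
theorem IsClosed.exists_first_ge {S : Set ℝ} (hS : IsClosed S) {a b : ℝ} (hab : a ≤ b)
    (hb : b ∈ S) : ∃ c ∈ S, a ≤ c ∧ c ≤ b ∧ ∀ t, a ≤ t → t < c → t ∉ S := by
  have hbd : BddBelow (S ∩ Ici a) := ⟨a, fun x hx => hx.2⟩
  have hc := (hS.inter isClosed_Ici).csInf_mem ⟨b, hb, hab⟩ hbd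
  refine ⟨sInf (S ∩ Ici a), hc.1, hc.2, csInf_le hbd ⟨hb, hab⟩, fun t hat ht hts => ?_⟩
  exact absurd (csInf_le hbd ⟨hts, hat⟩) (not_le.mpr ht)

/-- A function that crosses the level `a` only upwards stays above it. -/
theorem lt_of_hasDerivAt_pos_on_level {f f' : ℝ → ℝ} (hf : ∀ t, HasDerivAt f (f' t) t) {a : ℝ}
    (ha : ∀ t, f t = a → 0 < f' t) {s t : ℝ} (hs : a ≤ f s) (hst : s < t) : a < f t := by
  have hc : Continuous f := continuous_iff_continuousAt.mpr fun t => (hf t).continuousAt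
  by_contra! ht
  have h1 : ∀ᶠ y in 𝓝[>] s, a < f y := by
    rcases hs.eq_or_lt with h | h
    · have := (hf s).eventually_lt_right (ha s h.symm)
      rwa [← h] at this
    · exact nhdsWithin_le_nhds (hc.continuousAt.eventually (lt_mem_nhds h))
  obtain ⟨b, hb, hsb, hbt⟩ := (h1.and (Ioo_mem_nhdsGT hst)).exists
  obtain ⟨c, hcS, hbc, -, hfirst⟩ := (isClosed_le hc continuous_const).exists_first_ge
    (S := {y | f y ≤ a}) hbt.le ht
  have hbc' : b < c := lt_of_le_of_ne hbc fun h => absurd hcS (by rw [← h]; exact not_le.mpr hb)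
  have h2 : ∀ y, b ≤ y → y < c → a < f y := fun y h3 h4 => not_le.mp (hfirst y h3 h4)
  have h3 : a ≤ f c := by
    have : ∀ᶠ y in 𝓝[<] c, a ≤ f y := by
      filter_upwards [Ioo_mem_nhdsLT hbc'] with y hy
      exact (h2 y hy.1.le hy.2).le
    exact ge_of_tendsto (hc.continuousAt.tendsto.mono_left nhdsWithin_le_nhds) this
  have h4 : f c = a := le_antisymm hcS h3
  obtain ⟨y, hy, hy1, hy2⟩ :=
    (((hf c).eventually_lt_left (ha c h4)).and (Ioo_mem_nhdsLT hbc')).exists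
  have := h2 y hy1.le hy2
  linarith

theorem pos_of_continuousOn_of_ne_zero {f : ℝ → ℝ} {a b : ℝ} (hab : a ≤ b)
    (hf : ContinuousOn f (Icc a b)) (h0 : ∀ t ∈ Icc a b, f t ≠ 0) (ha : 0 < f a) : 0 < f b := by
  by_contra! hb
  obtain ⟨c, hc, hc0⟩ := intermediate_value_Icc' hab hf ⟨hb, ha.le⟩
  exact h0 c hc hc0

/-- A continuous injective function on a compact interval has a continuous inverse on its range. -/
theorem exists_continuousOn_inverse {f : ℝ → ℝ} {a b : ℝ} (hf : ContinuousOn f (Icc a b))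
    (hi : InjOn f (Icc a b)) : ∃ φ : ℝ → ℝ, ContinuousOn φ (f '' Icc a b) ∧
      ∀ y ∈ f '' Icc a b, φ y ∈ Icc a b ∧ f (φ y) = y := by
  refine ⟨Function.invFunOn f (Icc a b), ?_, fun y hy =>
    ⟨Function.invFunOn_mem hy, Function.invFunOn_eq hy⟩⟩
  rw [continuousOn_iff_isClosed]
  intro t ht
  refine ⟨f '' (t ∩ Icc a b), ?_, ?_⟩
  · exact ((isCompact_Icc.inter_left ht).image_of_continuousOn
      (hf.mono inter_subset_right)).isClosed
  · ext y
    constructor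
    · rintro ⟨h1, h2⟩
      exact ⟨⟨_, ⟨h1, Function.invFunOn_mem h2⟩, Function.invFunOn_eq h2⟩, h2⟩
    · rintro ⟨⟨x, ⟨hx1, hx2⟩, rfl⟩, h2⟩
      refine ⟨?_, h2⟩
      have : Function.invFunOn f (Icc a b) (f x) = x :=
        hi (Function.invFunOn_mem h2) hx2 (Function.invFunOn_eq h2)
      rwa [mem_preimage, this]

/-- Trapping for a polar system `θ' = 1 + r g(θ)`, `r > 0`: an orbit that turns back at time `t₁`
and forth again at time `t₂`, at the angle that it had at time `t₀`, never gets beyond the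
angle of time `t₁`, unless it meets itself. -/
theorem polar_trap {θ r g : ℝ → ℝ} (hθ : ∀ t, HasDerivAt θ (1 + r t * g (θ t)) t)
    (hr : Continuous r) (hr0 : ∀ t, 0 < r t)
    (hinj : ∀ s t, θ s = θ t → r s = r t → s = t) {t₀ t₁ t₂ : ℝ} (h01 : t₀ < t₁) (h12 : t₁ < t₂)
    (hup : ∀ t, t₀ ≤ t → t < t₁ → 0 < 1 + r t * g (θ t))
    (hdown : ∀ t, t₁ < t → t < t₂ → 1 + r t * g (θ t) < 0)
    (h02 : θ t₀ = θ t₂) (h2 : 1 + r t₂ * g (θ t₂) = 0)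
    (hafter : ∀ᶠ t in 𝓝[>] t₂, 0 < 1 + r t * g (θ t)) {t₃ : ℝ} (h23 : t₂ < t₃)
    (h3 : θ t₁ ≤ θ t₃) : False := by
  have hc : Continuous θ := continuous_iff_continuousAt.mpr fun t => (hθ t).continuousAt
  have hmono : StrictMonoOn θ (Icc t₀ t₁) := by
    refine strictMonoOn_of_hasDerivWithinAt_pos (convex_Icc _ _) hc.continuousOn
      (f' := fun t => 1 + r t * g (θ t)) (fun t _ => (hθ t).hasDerivWithinAt) fun t ht => ?_
    rw [interior_Icc] at ht
    exact hup t ht.1.le ht.2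
  have hanti : StrictAntiOn θ (Icc t₁ t₂) := by
    refine strictAntiOn_of_hasDerivWithinAt_neg (convex_Icc _ _) hc.continuousOn
      (f' := fun t => 1 + r t * g (θ t)) (fun t _ => (hθ t).hasDerivWithinAt) fun t ht => ?_
    rw [interior_Icc] at ht
    exact hdown t ht.1 ht.2
  have h21 : θ t₂ < θ t₁ :=
    hanti (left_mem_Icc.mpr h12.le) (right_mem_Icc.mpr h12.le) h12
  -- The arcs over [t₀, t₁] and [t₁, t₂] become graphs over the angle: r ∘ φ is the lower boundary
  -- of the trap, r ∘ ψ the upper one.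
  obtain ⟨φ, hφc, hφ⟩ := exists_continuousOn_inverse hc.continuousOn hmono.injOn
  obtain ⟨ψ, hψc, hψ⟩ := exists_continuousOn_inverse hc.continuousOn hanti.injOn
  have hI : Icc (θ t₂) (θ t₁) ⊆ θ '' Icc t₀ t₁ := by
    rw [← h02]; exact intermediate_value_Icc h01.le hc.continuousOn
  have hJ : Icc (θ t₂) (θ t₁) ⊆ θ '' Icc t₁ t₂ := intermediate_value_Icc' h12.le hc.continuousOn
  -- At a fixed angle with g < 0, θ' decreases in r, so forward motion takes place at smaller radius
  -- than backward motion.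
  have hcmp : ∀ s t, θ s = θ t → 0 < 1 + r s * g (θ s) → 1 + r t * g (θ t) ≤ 0 → r s < r t := by
    intro s t hst hs ht
    rw [hst] at hs
    have hg : g (θ t) < 0 := by
      by_contra! hg
      have := mul_nonneg (hr0 t).le hg
      linarith
    by_contra! hle
    have := mul_le_mul_of_nonpos_right hle hg.le
    linarith
  -- a time shortly after `t₂`
  have hnear : ∀ᶠ t in 𝓝[>] t₂, θ t < θ t₁ :=
    nhdsWithin_le_nhds (hc.continuousAt.eventually (gt_mem_nhds h21))
  obtain ⟨e, he, hesub⟩ := mem_nhdsGT_iff_exists_Ioo_subset.mp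
    ((hafter.and hnear).and (Ioo_mem_nhdsGT h23))
  rw [mem_Ioi] at he
  have hafter' : ∀ t, t₂ < t → t < e → 0 < 1 + r t * g (θ t) ∧ θ t < θ t₁ ∧ t < t₃ :=
    fun t h1 h2 => ⟨(hesub ⟨h1, h2⟩).1.1, (hesub ⟨h1, h2⟩).1.2, (hesub ⟨h1, h2⟩).2.2⟩
  have hmono2 : StrictMonoOn θ (Ico t₂ e) := by
    refine strictMonoOn_of_hasDerivWithinAt_pos (convex_Ico _ _) hc.continuousOn
      (f' := fun t => 1 + r t * g (θ t)) (fun t _ => (hθ t).hasDerivWithinAt) fun t ht => ?_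
    rw [interior_Ico] at ht
    exact (hafter' t ht.1 ht.2).1
  have hgt2 : ∀ t, t₂ < t → t < e → θ t₂ < θ t := fun t h1 h2 =>
    hmono2 ⟨le_rfl, he⟩ ⟨h1.le, h2⟩ h1
  -- the lower boundary of the trap lies below the orbit shortly after `t₂`
  have hφ2 : φ (θ t₂) = t₀ := by
    have h4 := hφ (θ t₂) (hI ⟨le_rfl, h21.le⟩)
    exact hmono.injOn h4.1 (left_mem_Icc.mpr h01.le) (h4.2.trans h02.symm)
  have hlow2 : r (φ (θ t₂)) < r t₂ := by
    rw [hφ2]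
    exact hcmp _ _ h02 (hup t₀ le_rfl h01) h2.le
  have hu : ContinuousOn (fun t => r t - r (φ (θ t))) (θ ⁻¹' Icc (θ t₂) (θ t₁)) :=
    hr.continuousOn.sub (hr.comp_continuousOn
      ((hφc.mono hI).comp hc.continuousOn fun t ht => ht))
  have hU : ContinuousOn (fun t => r (ψ (θ t)) - r t) (θ ⁻¹' Icc (θ t₂) (θ t₁)) :=
    (hr.comp_continuousOn ((hψc.mono hJ).comp hc.continuousOn fun t ht => ht)).sub
      hr.continuousOn
  have hφne : ∀ t, t₂ < t → θ t ∈ Icc (θ t₂) (θ t₁) → r t - r (φ (θ t)) ≠ 0 := by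
    intro t ht hm h0
    have h4 := hφ _ (hI hm)
    have h5 := hinj t _ h4.2.symm (sub_eq_zero.mp h0)
    have := h4.1.2
    linarith
  have hψne : ∀ t, t₂ < t → θ t ∈ Icc (θ t₂) (θ t₁) → r (ψ (θ t)) - r t ≠ 0 := by
    intro t ht hm h0
    have h4 := hψ _ (hJ hm)
    have h5 := hinj _ t h4.2 (sub_eq_zero.mp h0)
    have := h4.1.2
    linarith
  -- first exit from the range of angles
  set b := (t₂ + e) / 2 with hb
  have hb2 : t₂ < b := by linarith
  have hbe : b < e := by linarith
  obtain ⟨-, hb1, hb3⟩ := hafter' b hb2 hbe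
  obtain ⟨c, hcS, hbc, -, hfirst⟩ :=
    (isOpen_Ioo.preimage hc).isClosed_compl.exists_first_ge
      (S := (θ ⁻¹' Ioo (θ t₂) (θ t₁))ᶜ) hb3.le (fun h => absurd h.2 (not_lt.mpr h3))
  have hbc' : b < c := lt_of_le_of_ne hbc fun h =>
    hcS (by rw [← h]; exact ⟨hgt2 b hb2 hbe, hb1⟩)
  have hin : ∀ t, t₂ < t → t < c → θ t ∈ Ioo (θ t₂) (θ t₁) := by
    intro t ht htc
    rcases lt_or_ge t b with h | h
    · exact ⟨hgt2 t ht (h.trans hbe), (hafter' t ht (h.trans hbe)).2.1⟩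
    · exact not_not.mp (hfirst t h htc)
  have h2c : t₂ < c := hb2.trans hbc'
  have hcI : θ c ∈ Icc (θ t₂) (θ t₁) := by
    refine isClosed_Icc.mem_of_tendsto
      (hc.continuousAt.tendsto.mono_left (nhdsWithin_le_nhds (s := Iio c))) ?_
    filter_upwards [Ioo_mem_nhdsLT h2c] with y hy
    exact Ioo_subset_Icc_self (hin y hy.1 hy.2)
  have hin' : ∀ t, t₂ ≤ t → t ≤ c → θ t ∈ Icc (θ t₂) (θ t₁) := by
    intro t ht htc
    rcases ht.eq_or_lt with rfl | ht
    · exact ⟨le_rfl, h21.le⟩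
    rcases htc.eq_or_lt with rfl | htc
    · exact hcI
    exact Ioo_subset_Icc_self (hin t ht htc)
  have hlow : 0 < r c - r (φ (θ c)) := by
    refine pos_of_continuousOn_of_ne_zero (f := fun t => r t - r (φ (θ t))) h2c.le (hu.mono fun t ht => hin' t ht.1 ht.2)
      (fun t ht => ?_) (sub_pos.mpr hlow2)
    rcases ht.1.eq_or_lt with rfl | h
    · exact (sub_pos.mpr hlow2).ne'
    · exact hφne t h (hin' t ht.1 ht.2)
  have hupp : 0 < r (ψ (θ c)) - r c := by
    refine pos_of_continuousOn_of_ne_zero (f := fun t => r (ψ (θ t)) - r t) hbc (hU.mono fun t ht => hin' t (hb2.le.trans ht.1) ht.2)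
      (fun t ht => hψne t (hb2.trans_le ht.1) (hin' t (hb2.le.trans ht.1) ht.2)) ?_
    have hbm := hin b hb2 hbc'
    have h4 := hψ (θ b) (hJ (Ioo_subset_Icc_self hbm))
    have h5 : t₁ < ψ (θ b) := lt_of_le_of_ne h4.1.1 fun h => by
      rw [← h] at h4; exact hbm.2.ne h4.2.symm
    have h6 : ψ (θ b) < t₂ := lt_of_le_of_ne h4.1.2 fun h => by
      rw [h] at h4; exact hbm.1.ne h4.2
    exact sub_pos.mpr (hcmp b _ h4.2.symm (hafter' b hb2 hbe).1 (hdown _ h5 h6).le)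
  rcases hcI.1.eq_or_lt with h | h
  -- Exit through the initial ray: the orbit is below r t₂ there, so θ' > 0 and it could only be
  -- entering.
  · have hψ2 : ψ (θ c) = t₂ := by
      have h4 := hψ _ (hJ hcI)
      exact hanti.injOn h4.1 (right_mem_Icc.mpr h12.le) (h4.2.trans h.symm)
    rw [hψ2, sub_pos] at hupp
    have hw : 0 < 1 + r c * g (θ c) := by
      rw [← h]
      have hg : g (θ t₂) < 0 := by
        by_contra! hg
        have := mul_nonneg (hr0 t₂).le hg
        linarith
      have := mul_lt_mul_of_neg_right hupp hg
      linarith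
    obtain ⟨y, hy, hy1, hy2⟩ :=
      (((hθ c).eventually_lt_left hw).and (Ioo_mem_nhdsLT h2c)).exists
    have := (hin y hy1 hy2).1
    linarith
  -- Exit at the tip: both arcs have radius r t₁ there, which leaves no room between them.
  · have h5 : θ c = θ t₁ := by
      refine le_antisymm hcI.2 ?_
      by_contra! h6
      exact hcS ⟨h, h6⟩
    have hψ1 : ψ (θ c) = t₁ := by
      have h4 := hψ _ (hJ hcI)
      exact hanti.injOn h4.1 (left_mem_Icc.mpr h12.le) (h4.2.trans h5)
    have hφ1 : φ (θ c) = t₁ := by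
      have h4 := hφ _ (hI hcI)
      exact hmono.injOn h4.1 (right_mem_Icc.mpr h01.le) (h4.2.trans h5)
    rw [hψ1] at hupp
    rw [hφ1] at hlow
    linarith

/-- An orbit of a polar system `θ' = 1 + r g(θ)`, `r > 0`, that starts with `θ' > 0` at an angle to
which it does not return, reaches every angle, does not meet itself and is transversal to the curve
`θ' = 0`, has `θ' > 0` for all later times. -/
theorem polar_angle_deriv_pos {θ r g w' : ℝ → ℝ}
    (hθ : ∀ t, HasDerivAt θ (1 + r t * g (θ t)) t)
    (hw : ∀ t, HasDerivAt (fun t => 1 + r t * g (θ t)) (w' t) t)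
    (hr : Continuous r) (hr0 : ∀ t, 0 < r t)
    (hinj : ∀ s t, θ s = θ t → r s = r t → s = t)
    (hreg : ∀ t, 1 + r t * g (θ t) = 0 → w' t ≠ 0)
    {ta : ℝ} (hstart : 0 < 1 + r ta * g (θ ta)) (hret : ∀ t, ta < t → θ ta < θ t)
    (hunb : ∀ s M, ∃ t, s < t ∧ M ≤ θ t) {t : ℝ} (ht : ta ≤ t) : 0 < 1 + r t * g (θ t) := by
  by_contra! htn
  set w : ℝ → ℝ := fun t => 1 + r t * g (θ t) with hwdef
  have hc : Continuous θ := continuous_iff_continuousAt.mpr fun t => (hθ t).continuousAt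
  have hwc : Continuous w := continuous_iff_continuousAt.mpr fun t => (hw t).continuousAt
  obtain ⟨t₁, h1S, ha1, -, h1⟩ := (isClosed_le hwc continuous_const).exists_first_ge
    (S := {y | w y ≤ 0}) ht htn
  have ha1' : ta < t₁ := lt_of_le_of_ne ha1 fun h => absurd h1S (by rw [← h]; exact not_le.mpr hstart)
  have hup : ∀ s, ta ≤ s → s < t₁ → 0 < w s := fun s h3 h4 => not_le.mp (h1 s h3 h4)
  have hw1 : w t₁ = 0 := by
    refine le_antisymm h1S (ge_of_tendsto
      (hwc.continuousAt.tendsto.mono_left (nhdsWithin_le_nhds (s := Iio t₁))) ?_)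
    filter_upwards [Ioo_mem_nhdsLT ha1'] with y hy
    exact (hup y hy.1.le hy.2).le
  have hd1 : w' t₁ < 0 := by
    refine lt_of_le_of_ne ?_ (hreg t₁ hw1)
    by_contra! h3
    obtain ⟨y, hy, hy1, hy2⟩ :=
      (((hw t₁).eventually_lt_left h3).and (Ioo_mem_nhdsLT ha1')).exists
    have h4 := hup y hy1.le hy2
    change w y < w t₁ at hy
    linarith
  have hneg : ∀ᶠ y in 𝓝[>] t₁, w y < 0 := by
    have := (hw t₁).neg.eventually_lt_right (neg_pos.mpr hd1)
    filter_upwards [this] with y hy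
    change - w t₁ < - w y at hy
    linarith
  obtain ⟨e, he, hesub⟩ := mem_nhdsGT_iff_exists_Ioo_subset.mp hneg
  rw [mem_Ioi] at he
  set b := (t₁ + e) / 2 with hb
  have hb1 : t₁ < b := by linarith
  have hbe : b < e := by linarith
  -- `θ'` has to become nonnegative again
  obtain ⟨t', ht'b, hwt'⟩ : ∃ t', b ≤ t' ∧ 0 ≤ w t' := by
    by_contra! hno
    obtain ⟨s, hs1, hs2⟩ := hunb b (θ b + 1)
    have : StrictAntiOn θ (Ici b) := by
      refine strictAntiOn_of_hasDerivWithinAt_neg (convex_Ici _) hc.continuousOn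
        (f' := w) (fun t _ => (hθ t).hasDerivWithinAt) fun t ht => ?_
      exact hno t (interior_subset ht)
    have := this self_mem_Ici hs1.le hs1
    linarith
  obtain ⟨t₂, h2S, hb2, -, h2⟩ := (isClosed_le continuous_const hwc).exists_first_ge
    (S := {y | 0 ≤ w y}) ht'b hwt'
  have hb2' : b < t₂ := lt_of_le_of_ne hb2 fun h =>
    absurd h2S (by rw [← h]; exact not_le.mpr (show w b < 0 from hesub ⟨hb1, hbe⟩))
  have h12 : t₁ < t₂ := hb1.trans hb2'
  have hdown : ∀ s, t₁ < s → s < t₂ → w s < 0 := by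
    intro s h3 h4
    rcases lt_or_ge s b with h | h
    · exact hesub ⟨h3, h.trans hbe⟩
    · exact not_le.mp (h2 s h h4)
  have hw2 : w t₂ = 0 := by
    refine le_antisymm (le_of_tendsto
      (hwc.continuousAt.tendsto.mono_left (nhdsWithin_le_nhds (s := Iio t₂))) ?_) h2S
    filter_upwards [Ioo_mem_nhdsLT h12] with y hy
    exact (hdown y hy.1 hy.2).le
  have hd2 : 0 < w' t₂ := by
    refine lt_of_le_of_ne ?_ (hreg t₂ hw2).symm
    by_contra! h3
    obtain ⟨y, hy, hy1, hy2⟩ :=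
      (((hw t₂).neg.eventually_lt_left (neg_pos.mpr h3)).and (Ioo_mem_nhdsLT h12)).exists
    have h4 := hdown y hy1 hy2
    change - w y < - w t₂ at hy
    linarith
  have hafter : ∀ᶠ y in 𝓝[>] t₂, 0 < w y := by
    filter_upwards [(hw t₂).eventually_lt_right hd2] with y hy
    change w t₂ < w y at hy
    linarith
  have hanti : StrictAntiOn θ (Icc t₁ t₂) := by
    refine strictAntiOn_of_hasDerivWithinAt_neg (convex_Icc _ _) hc.continuousOn
      (f' := w) (fun t _ => (hθ t).hasDerivWithinAt) fun t ht => ?_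
    rw [interior_Icc] at ht
    exact hdown t ht.1 ht.2
  have h21 : θ t₂ < θ t₁ :=
    hanti (left_mem_Icc.mpr h12.le) (right_mem_Icc.mpr h12.le) h12
  have h2a : θ ta < θ t₂ := hret t₂ (ha1'.trans h12)
  -- The backward arc cannot get back to the starting angle, so its final angle was already passed
  -- on the way up.
  obtain ⟨t₀, ht₀, h02⟩ := intermediate_value_Icc ha1 hc.continuousOn ⟨h2a.le, h21.le⟩
  have h01 : t₀ < t₁ := lt_of_le_of_ne ht₀.2 fun h => by rw [h] at h02; exact h21.ne h02.symm
  obtain ⟨t₃, h23, h3⟩ := hunb t₂ (θ t₁)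
  exact polar_trap hθ hr hr0 hinj h01 h12 (fun s h4 h5 => hup s (ht₀.1.trans h4) h5) hdown h02 hw2
    hafter h23 h3

end

/-! ### Polynomial estimates. -/

/-- If every root of `f` has distance at least `d` from `x`, then `‖f‖` grows at most by a factor
`3 / d` per degree on the disc of radius `2` around `x`. -/
theorem Polynomial.norm_eval_le_of_le_norm_sub_roots (f : Polynomial ℂ) {n : ℕ}
    (hn : f.natDegree ≤ n) {d : ℝ} (hd : 0 < d) (hd1 : d ≤ 1) {x y : ℂ} (hxy : ‖y - x‖ ≤ 2)
    (hr : ∀ k ∈ f.roots, d ≤ ‖x - k‖) : ‖f.eval y‖ ≤ ‖f.eval x‖ * (3 / d) ^ n := by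
  have key : ∀ s : Multiset ℂ, (∀ k ∈ s, d ≤ ‖x - k‖) →
      ‖(s.map fun k => y - k).prod‖ ≤ ‖(s.map fun k => x - k).prod‖ * (3 / d) ^ s.card := by
    intro s
    induction s using Multiset.induction_on with
    | empty => simp
    | cons a s ih =>
      intro hs
      have h1 := ih fun k hk => hs k (Multiset.mem_cons_of_mem hk)
      have h2 := hs a (Multiset.mem_cons_self a s)
      -- |y - a| ≤ 2 + |x - a|, and 2 + d ≤ 3.
      have h3 : ‖y - a‖ ≤ ‖x - a‖ * (3 / d) := by
        have h4 : ‖y - a‖ ≤ ‖y - x‖ + ‖x - a‖ := norm_sub_le_norm_sub_add_norm_sub y x a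
        rw [mul_div_assoc', le_div_iff₀ hd]
        nlinarith [norm_nonneg (y - a)]
      rw [Multiset.map_cons, Multiset.prod_cons, Multiset.map_cons, Multiset.prod_cons,
        Multiset.card_cons, norm_mul, norm_mul, pow_succ]
      calc _ ≤ (‖x - a‖ * (3 / d)) * (‖(s.map fun k => x - k).prod‖ * (3 / d) ^ s.card) := by
            gcongr
        _ = _ := by ring
  have hsp := IsAlgClosed.splits f
  rw [hsp.eval_eq_prod_roots y, hsp.eval_eq_prod_roots x, norm_mul, norm_mul, mul_assoc]
  gcongr
  refine (key _ hr).trans ?_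
  gcongr
  · rw [le_div_iff₀ hd]; linarith
  · exact (f.card_roots').trans hn

/-- A cubic polynomial attains at one of the fourth roots of unity a value whose modulus is at least
the `ℓ²` norm of its coefficients. -/
theorem Complex.exists_fourth_root_le_norm_cubic (a b c d : ℂ) :
    ∃ k : ℂ, ‖k‖ = 1 ∧ ‖a‖ ^ 2 + ‖b‖ ^ 2 + ‖c‖ ^ 2 + ‖d‖ ^ 2
      ≤ ‖a * k ^ 3 + b * k ^ 2 + c * k + d‖ ^ 2 := by
  -- Parseval: for degree at most 3, the mean of the squared modulus over the four fourth roots of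
  -- unity is the sum of the squared coefficients.
  by_contra! hk
  have h1 := hk 1 (by simp)
  have h2 := hk (-1) (by simp)
  have h3 := hk Complex.I (by simp)
  have h4 := hk (-Complex.I) (by simp)
  have e : ∀ u : ℂ, ‖u‖ ^ 2 = u.re ^ 2 + u.im ^ 2 := fun u => by
    rw [Complex.sq_norm, Complex.normSq_apply]; ring
  have i3 : Complex.I ^ 3 = -Complex.I := Complex.I_pow_three
  have j3 : (-Complex.I) ^ 3 = Complex.I := by rw [Odd.neg_pow (by decide), i3, neg_neg]
  rw [i3, Complex.I_sq] at h3
  rw [j3, neg_sq, Complex.I_sq] at h4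
  simp only [e] at h1 h2 h3 h4
  simp at h1 h2 h3 h4
  norm_num at h1 h2 h3 h4
  nlinarith

/-! ### Complex singular points and the lower bound of v(z)/z. -/

namespace QuadParam

/-- The coefficient `H(k) = A + B k + C k²` of the field on the complex line `η = k ζ`. -/
def lineCoeff (p : QuadParam) (k : ℂ) : ℂ := p.A + p.B * k + p.C * k ^ 2

/-- The cubic whose roots are the slopes `k` of the complex lines `η = k ζ` through the origin that
contain another singular point (possibly at infinity), where `ζ = x + i y` and `η = x - i y`. -/
noncomputable def slopeCubic (p : QuadParam) : Polynomial ℂ :=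
  Polynomial.C p.C * Polynomial.X ^ 3 + Polynomial.C p.devB * Polynomial.X ^ 2
    + Polynomial.C (-(p.mu / conj p.mu * conj p.devB)) * Polynomial.X
    + Polynomial.C (-(p.mu / conj p.mu * conj p.C))

theorem natDegree_slopeCubic_le (p : QuadParam) : p.slopeCubic.natDegree ≤ 3 := by
  unfold slopeCubic
  exact Polynomial.natDegree_cubic_le

theorem conj_mu_ne_zero (p : QuadParam) : conj p.mu ≠ 0 := by simpa using p.mu_ne_zero

/-- Up to sign, the right side is the determinant of μ + ζ H(k) = 0 and μ̄ k + ζ (Ā k² + B̄ k + C̄)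
= 0, the equations of a singular point with η = kζ, ζ ≠ 0. -/
theorem conj_mu_mul_eval_slopeCubic (p : QuadParam) (k : ℂ) :
    conj p.mu * p.slopeCubic.eval k = conj p.mu * k * p.lineCoeff k
      - p.mu * (conj p.A * k ^ 2 + conj p.B * k + conj p.C) := by
  have h1 := p.mu_ne_zero
  have h2 := p.conj_mu_ne_zero
  simp only [slopeCubic, Polynomial.eval_add, Polynomial.eval_mul, Polynomial.eval_C,
    Polynomial.eval_pow, Polynomial.eval_X]
  simp only [lineCoeff, devB, map_sub, map_mul, map_div₀, Complex.conj_conj]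
  field_simp
  ring

theorem norm_mu_div_conj_mu (p : QuadParam) : ‖p.mu / conj p.mu‖ = 1 := by
  rw [norm_div, Complex.norm_conj, div_self (norm_ne_zero_iff.mpr p.mu_ne_zero)]

theorem one_le_norm_mu (p : QuadParam) : 1 ≤ ‖p.mu‖ := by
  have := Complex.abs_im_le_norm p.mu
  simpa [mu] using this

theorem IsNormalized.norm_le {p : QuadParam} (hp : p.IsNormalized) :
    ‖p.A‖ ≤ 1 ∧ ‖p.B‖ ≤ 2 ∧ ‖p.C‖ ≤ 1 := by
  rcases hp.2 with ⟨h1, h2, h3⟩ | ⟨h1, h2, h3⟩ | ⟨h1, h2, h3⟩ <;> simp [*]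

theorem IsNormalized.lt_four {p : QuadParam} (hp : p.IsNormalized) {κ : ℝ}
    (hdist : p.IsDistantFromSingular κ) : κ < 4 := by
  obtain ⟨hA, hB, hC⟩ := hp.norm_le
  refine lt_of_lt_of_le hdist (Real.sqrt_le_iff.mpr ⟨by norm_num, ?_⟩)
  have h1 : ‖p.devB‖ ≤ ‖p.B‖ + ‖p.mu / conj p.mu * conj p.A‖ := norm_sub_le _ _
  rw [norm_mul, norm_mu_div_conj_mu, Complex.norm_conj] at h1
  nlinarith [norm_nonneg p.devB, norm_nonneg p.C]

/-- A root of the slope cubic gives a complex singular point on the corresponding line. -/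
theorem isSingularPoint_of_slope (p : QuadParam) {k : ℂ} (hk : p.slopeCubic.eval k = 0)
    (hH : p.lineCoeff k ≠ 0) {ζ η : ℂ} (hζ : ζ = -p.mu / p.lineCoeff k) (hη : η = k * ζ) :
    p.IsSingularPoint ((ζ + η) / 2) ((ζ - η) / (2 * Complex.I)) := by
  have hI := Complex.I_ne_zero
  have e1 : (ζ + η) / 2 + Complex.I * ((ζ - η) / (2 * Complex.I)) = ζ := by field_simp; ring
  have e2 : (ζ + η) / 2 - Complex.I * ((ζ - η) / (2 * Complex.I)) = η := by field_simp; ring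
  have hz : ζ * p.lineCoeff k = -p.mu := by rw [hζ]; field_simp
  have hq := p.conj_mu_mul_eval_slopeCubic k
  rw [hk, mul_zero] at hq
  unfold IsSingularPoint
  rw [e1, e2, hη]
  constructor
  · unfold lineCoeff at hz
    linear_combination ζ * hz
  · have h3 : p.mu * (conj p.mu * (k * ζ) + conj p.A * (k * ζ) ^ 2 + conj p.B * (ζ * (k * ζ))
        + conj p.C * ζ ^ 2) = 0 := by
      linear_combination ζ ^ 2 * hq + conj p.mu * k * ζ * hz
    exact (mul_eq_zero.mp h3).resolve_left p.mu_ne_zero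

/-- The logarithmic velocity `v(z) / z = ρ + i θ'`. -/
noncomputable def logVel (p : QuadParam) (z : ℂ) : ℂ := p.field z / z

theorem logVel_eq (p : QuadParam) {z : ℂ} (hz : z ≠ 0) :
    p.logVel z = p.mu + z * p.lineCoeff (conj z / z) := by
  unfold logVel field lineCoeff
  field_simp
  ring

/-- For the cubic P, with E = v(z)/z and k₀ = z̄/z, eliminating H(k₀) gives μ̄ P(k₀) z = k₀ (μ̄ E -
μ Ē). -/
theorem norm_slopeCubic_mul_norm_le (p : QuadParam) {z : ℂ} (hz : z ≠ 0) :
    ‖p.slopeCubic.eval (conj z / z)‖ * ‖z‖ ≤ 2 * ‖p.logVel z‖ := by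
  have hz' : conj z ≠ 0 := by simpa using hz
  have h1 := p.conj_mu_mul_eval_slopeCubic (conj z / z)
  have h2 := p.logVel_eq hz
  have h3 : conj p.mu * (p.slopeCubic.eval (conj z / z) * z)
      = conj z / z * (conj p.mu * p.logVel z - p.mu * conj (p.logVel z)) := by
    rw [h2, ← mul_assoc, h1]
    unfold lineCoeff
    simp only [map_add, map_mul, map_pow, map_div₀, Complex.conj_conj]
    field_simp
    ring
  have h4 := congrArg norm h3
  have h5 : ‖conj z / z‖ = 1 := by
    rw [norm_div, Complex.norm_conj, div_self (norm_ne_zero_iff.mpr hz)]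
  rw [norm_mul, norm_mul, norm_mul, h5, one_mul, Complex.norm_conj] at h4
  have h6 := norm_sub_le (conj p.mu * p.logVel z) (p.mu * conj (p.logVel z))
  rw [norm_mul, norm_mul, Complex.norm_conj, Complex.norm_conj] at h6
  have h7 : 0 < ‖p.mu‖ := norm_pos_iff.mpr p.mu_ne_zero
  refine le_of_mul_le_mul_left ?_ h7
  linarith

theorem norm_lineCoeff_sub_le (p : QuadParam) (hp : p.IsNormalized) {k k₀ : ℂ} (h0 : ‖k₀‖ = 1)
    (h1 : ‖k₀ - k‖ ≤ 1) : ‖p.lineCoeff k - p.lineCoeff k₀‖ ≤ 5 * ‖k₀ - k‖ := by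
  obtain ⟨-, hB, hC⟩ := hp.norm_le
  have e : p.lineCoeff k - p.lineCoeff k₀ = (p.B + p.C * (k + k₀)) * (k - k₀) := by
    unfold lineCoeff; ring
  rw [e, norm_mul, norm_sub_rev k]
  gcongr
  have h2 : ‖k‖ ≤ 2 := by
    have := norm_sub_norm_le k k₀
    rw [norm_sub_rev] at this
    linarith
  calc _ ≤ ‖p.B‖ + ‖p.C‖ * (‖k‖ + ‖k₀‖) := by
        refine (norm_add_le _ _).trans ?_
        rw [norm_mul]
        gcongr
        exact norm_add_le _ _
    _ ≤ 2 + 1 * (2 + 1) := by gcongr; exact h0.le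
    _ = 5 := by norm_num

/-- At a tame point with small velocity, the slope of the point is far from the slopes of the
singular points. -/
theorem le_norm_slope_sub_root (p : QuadParam) (hp : p.IsNormalized) {δ : ℝ} (hδ : 0 < δ)
    (hδ1 : δ < 1) {z : ℂ} (hz : z ≠ 0) (ht : z ∈ p.tameDomain δ)
    (hv : ‖p.logVel z‖ ≤ δ ^ 2 / 20) {k : ℂ} (hk : p.slopeCubic.eval k = 0) :
    δ ^ 3 / 40 ≤ ‖conj z / z - k‖ := by
  by_contra! hd
  obtain ⟨hzδ, hsing⟩ := ht
  set k₀ := conj z / z with hk₀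
  set d := ‖k₀ - k‖ with hdd
  have hk₀1 : ‖k₀‖ = 1 := by
    rw [hk₀, norm_div, Complex.norm_conj, div_self (norm_ne_zero_iff.mpr hz)]
  have hd2 : δ ^ 2 < 1 := by nlinarith
  have hd3 : δ ^ 3 < δ ^ 2 := by nlinarith [sq_pos_of_pos hδ]
  have hd32 : δ ^ 3 < δ := by nlinarith
  have hH := p.norm_lineCoeff_sub_le hp (k := k) hk₀1 (by linarith)
  have hlv := p.logVel_eq hz
  have hzp : 0 < ‖z‖ := norm_pos_iff.mpr hz
  have hz1 : ‖z‖ * δ ≤ 1 := by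
    rwa [← le_div_iff₀ hδ, one_div]
  have hH0 : 0.95 ≤ ‖z‖ * ‖p.lineCoeff k₀‖ := by
    have h1 : p.mu = p.logVel z - z * p.lineCoeff k₀ := by rw [hlv]; ring
    have h2 : ‖p.mu‖ ≤ ‖p.logVel z‖ + ‖z * p.lineCoeff k₀‖ := by
      conv_lhs => rw [h1]
      exact norm_sub_le _ _
    rw [norm_mul] at h2
    have := p.one_le_norm_mu
    linarith
  have hH1 : 0.95 * δ ≤ ‖p.lineCoeff k₀‖ := by
    have h1 : ‖z‖ * δ * ‖p.lineCoeff k₀‖ ≤ 1 * ‖p.lineCoeff k₀‖ := by gcongr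
    nlinarith
  have hH2 : 0.8 * δ ≤ ‖p.lineCoeff k‖ := by
    have h1 := norm_sub_norm_le (p.lineCoeff k₀) (p.lineCoeff k)
    rw [norm_sub_rev] at h1
    linarith
  have hHk : p.lineCoeff k ≠ 0 := by
    intro h0
    rw [h0, norm_zero] at hH2
    linarith
  set ζ := -p.mu / p.lineCoeff k with hζ
  have hs := p.isSingularPoint_of_slope hk hHk hζ rfl
  have hζ0 : ζ ≠ 0 := div_ne_zero (neg_ne_zero.mpr p.mu_ne_zero) hHk
  -- As μ + ζ H(k) = 0, the error splits into v(z)/z and the variation of H; 0.175 = 1/20 + 1/8.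
  have hζz : ‖z - ζ‖ * ‖p.lineCoeff k‖ ≤ δ ^ 2 * 0.175 := by
    have e : (z - ζ) * p.lineCoeff k
        = p.logVel z + z * (p.lineCoeff k - p.lineCoeff k₀) := by
      rw [hlv, hζ]
      field_simp
      ring
    rw [← norm_mul, e]
    refine (norm_add_le _ _).trans ?_
    rw [norm_mul]
    have h1 : ‖z‖ * ‖p.lineCoeff k - p.lineCoeff k₀‖ ≤ ‖z‖ * (δ * (δ ^ 2 / 8)) := by
      gcongr; linarith
    nlinarith [sq_pos_of_pos hδ]
  have hζz1 : ‖z - ζ‖ ≤ 0.3 * δ := by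
    by_contra! hc
    nlinarith [norm_nonneg (z - ζ)]
  have hη1 : ‖conj z - k * ζ‖ ≤ 0.5 * δ := by
    have e : conj z - k * ζ = k * (z - ζ) + (k₀ - k) * z := by
      rw [hk₀]; field_simp; ring
    have hk1 : ‖k‖ ≤ 1.1 := by
      have := norm_sub_norm_le k k₀
      rw [norm_sub_rev] at this
      linarith
    rw [e]
    refine (norm_add_le _ _).trans ?_
    rw [norm_mul, norm_mul]
    have h1 : ‖k‖ * ‖z - ζ‖ ≤ 1.1 * (0.3 * δ) := by gcongr
    have h2 : ‖k₀ - k‖ * ‖z‖ ≤ (δ * δ ^ 2 / 40) * ‖z‖ := by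
      gcongr; linarith
    nlinarith
  have hne : ((ζ + k * ζ) / 2, (ζ - k * ζ) / (2 * Complex.I)) ≠ ((0 : ℂ), (0 : ℂ)) := by
    intro h0
    rw [Prod.mk.injEq] at h0
    obtain ⟨h1, h2⟩ := h0
    rw [div_eq_zero_iff] at h1 h2
    have h1' := h1.resolve_right two_ne_zero
    have h2' := h2.resolve_right (by simp)
    exact hζ0 (by linear_combination (h1' + h2') / 2)
  have hfar := hsing _ _ hs hne
  have h0re : (z.re : ℂ) = (z + conj z) / 2 := Complex.re_eq_add_conj z
  have h0im : (z.im : ℂ) = (z - conj z) / (2 * Complex.I) := Complex.im_eq_sub_conj z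
  have e1 : (z.re : ℂ) - (ζ + k * ζ) / 2 = ((z - ζ) + (conj z - k * ζ)) / 2 := by
    rw [h0re]; ring
  have e2 : (z.im : ℂ) - (ζ - k * ζ) / (2 * Complex.I)
      = ((z - ζ) - (conj z - k * ζ)) / (2 * Complex.I) := by
    rw [h0im]; ring
  rw [e1, e2] at hfar
  have n1 : ‖((z - ζ) + (conj z - k * ζ)) / 2‖ ≤ 0.4 * δ := by
    rw [norm_div, Complex.norm_two]
    have := norm_add_le (z - ζ) (conj z - k * ζ)
    linarith
  have n2 : ‖((z - ζ) - (conj z - k * ζ)) / (2 * Complex.I)‖ ≤ 0.4 * δ := by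
    rw [norm_div, norm_mul, Complex.norm_two, Complex.norm_I, mul_one]
    have := norm_sub_le (z - ζ) (conj z - k * ζ)
    linarith
  have h3 : Real.sqrt (‖((z - ζ) + (conj z - k * ζ)) / 2‖ ^ 2
      + ‖((z - ζ) - (conj z - k * ζ)) / (2 * Complex.I)‖ ^ 2) < δ := by
    rw [Real.sqrt_lt' hδ]
    calc _ ≤ (0.4 * δ) ^ 2 + (0.4 * δ) ^ 2 := by gcongr
      _ < δ ^ 2 := by nlinarith [sq_pos_of_pos hδ]
  exact absurd hfar (not_le.mpr h3)

/-- Lower bound of the logarithmic velocity on the tame domain. -/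
theorem le_norm_logVel (p : QuadParam) (hp : p.IsNormalized) {δ κ : ℝ} (hδ : 0 < δ)
    (hδ1 : δ < 1) (hκ : 0 < κ) (hdist : p.IsDistantFromSingular κ) {z : ℂ}
    (ht : z ∈ p.tameDomain δ) (hz : 1 / 8 ≤ ‖z‖) :
    δ ^ 9 * κ / (3 * 10 ^ 7) ≤ ‖p.logVel z‖ := by
  have hz0 : z ≠ 0 := by
    rintro rfl
    rw [norm_zero] at hz
    norm_num at hz
  by_cases hv : ‖p.logVel z‖ ≤ δ ^ 2 / 20
  · set d := δ ^ 3 / 40 with hd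
    have hd0 : 0 < d := by positivity
    have hd1 : d ≤ 1 := by
      have : δ ^ 3 ≤ 1 := pow_le_one₀ hδ.le hδ1.le
      linarith
    obtain ⟨k, hk1, hk⟩ := Complex.exists_fourth_root_le_norm_cubic p.C p.devB
      (-(p.mu / conj p.mu * conj p.devB)) (-(p.mu / conj p.mu * conj p.C))
    rw [norm_neg, norm_neg, norm_mul, norm_mul, norm_mu_div_conj_mu, Complex.norm_conj,
      Complex.norm_conj, one_mul, one_mul] at hk
    have he : p.C * k ^ 3 + p.devB * k ^ 2 + -(p.mu / conj p.mu * conj p.devB) * k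
        + -(p.mu / conj p.mu * conj p.C) = p.slopeCubic.eval k := by
      simp [slopeCubic]
    rw [he] at hk
    have hκ2 : κ ^ 2 < ‖p.devB‖ ^ 2 + ‖p.C‖ ^ 2 := (Real.lt_sqrt hκ.le).mp hdist
    -- The squared ℓ² norm of the coefficients is 2(|b|² + |c|²).
    have hκ3 : κ ≤ ‖p.slopeCubic.eval k‖ := by
      refine le_of_sq_le_sq ?_ (norm_nonneg _)
      nlinarith [sq_nonneg ‖p.devB‖, sq_nonneg ‖p.C‖]
    have hk₀1 : ‖conj z / z‖ = 1 := by
      rw [norm_div, Complex.norm_conj, div_self (norm_ne_zero_iff.mpr hz0)]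
    have h1 := p.slopeCubic.norm_eval_le_of_le_norm_sub_roots p.natDegree_slopeCubic_le hd0 hd1
      (x := conj z / z) (y := k) ((norm_sub_le _ _).trans (by linarith)) (fun k₁ hk₁ =>
        p.le_norm_slope_sub_root hp hδ hδ1 hz0 ht hv (Polynomial.isRoot_of_mem_roots hk₁))
    have h2 := p.norm_slopeCubic_mul_norm_le hz0
    have h3 : ‖p.slopeCubic.eval (conj z / z)‖ ≤ 16 * ‖p.logVel z‖ := by
      nlinarith [norm_nonneg (p.slopeCubic.eval (conj z / z))]
    have h4 : κ * d ^ 3 ≤ 16 * ‖p.logVel z‖ * 27 := by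
      have h5 : κ ≤ (16 * ‖p.logVel z‖) * (3 / d) ^ 3 :=
        hκ3.trans (h1.trans (by gcongr))
      rw [div_pow, mul_div_assoc', le_div_iff₀ (by positivity)] at h5
      linarith
    -- The final constant absorbs 16 · 27 · 40³ = 27648000 ≤ 3 · 10⁷.
    have h6 : d ^ 3 = δ ^ 9 / 64000 := by rw [hd]; ring
    rw [h6] at h4
    have := norm_nonneg (p.logVel z)
    linarith
  · push Not at hv
    have hκ4 := hp.lt_four hdist
    have h9 : δ ^ 9 ≤ δ ^ 2 := pow_le_pow_of_le_one hδ.le hδ1.le (by norm_num)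
    have : δ ^ 9 * κ ≤ δ ^ 2 * 4 := by gcongr
    have := sq_pos_of_pos hδ
    linarith

end QuadParam

/-! ### Polar form and angular acceleration. -/

namespace QuadParam

theorem contDiff_field (p : QuadParam) : ContDiff ℝ 1 p.field := by
  have hc : ContDiff ℝ 1 (fun z : ℂ => conj z) := Complex.conjCLE.contDiff
  unfold field
  exact (((contDiff_const.mul contDiff_id).add (contDiff_const.mul (contDiff_id.pow 2))).add
    (contDiff_const.mul (contDiff_id.mul hc))).add (contDiff_const.mul (hc.pow 2))

theorem logVel_polar (p : QuadParam) {r : ℝ} (hr : r ≠ 0) (θ : ℝ) :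
    p.logVel (r * Complex.exp (Complex.I * θ)) = p.mu + r * p.h θ := by
  have h1 : (r : ℂ) * Complex.exp (Complex.I * θ) ≠ 0 :=
    mul_ne_zero (by exact_mod_cast hr) (Complex.exp_ne_zero _)
  rw [logVel, field_polar, mul_div_cancel_left₀ _ h1]

theorem logVel_polar_im (p : QuadParam) {r : ℝ} (hr : r ≠ 0) (θ : ℝ) :
    (p.logVel (r * Complex.exp (Complex.I * θ))).im = 1 + r * p.g θ := by
  rw [p.logVel_polar hr]
  simp [mu, g]

/-- The derivative of `h`. -/
noncomputable def hDeriv (p : QuadParam) (θ : ℝ) : ℂ :=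
  p.A * (Complex.exp (Complex.I * θ) * Complex.I)
    + p.B * (Complex.exp (-(Complex.I * θ)) * -Complex.I)
    + p.C * (Complex.exp (-(3 * (Complex.I * θ))) * -(3 * Complex.I))

theorem hasDerivAt_h (p : QuadParam) (θ : ℝ) : HasDerivAt p.h (p.hDeriv θ) θ := by
  have h1 : HasDerivAt (fun x : ℝ => Complex.I * (x : ℂ)) Complex.I θ := by
    simpa using (Complex.ofRealCLM.hasDerivAt (x := θ)).const_mul Complex.I
  have h3 : HasDerivAt (fun x : ℝ => 3 * (Complex.I * (x : ℂ))) (3 * Complex.I) θ :=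
    h1.const_mul 3
  exact ((h1.cexp.const_mul p.A).add (h1.neg.cexp.const_mul p.B)).add
    (h3.neg.cexp.const_mul p.C)

theorem hasDerivAt_g (p : QuadParam) (θ : ℝ) : HasDerivAt p.g (p.hDeriv θ).im θ :=
  (Complex.imCLM.hasFDerivAt.comp_hasDerivAt θ (p.hasDerivAt_h θ) :)

theorem norm_exp_I_mul (θ : ℝ) : ‖Complex.exp (Complex.I * θ)‖ = 1 := by
  rw [mul_comm]; exact Complex.norm_exp_ofReal_mul_I θ

theorem norm_exp_neg_I_mul (θ : ℝ) : ‖Complex.exp (-(Complex.I * θ))‖ = 1 := by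
  rw [Complex.exp_neg, norm_inv, norm_exp_I_mul, inv_one]

theorem norm_exp_neg_three_I_mul (θ : ℝ) : ‖Complex.exp (-(3 * (Complex.I * θ)))‖ = 1 := by
  have : 3 * (Complex.I * (θ : ℂ)) = Complex.I * ((3 * θ : ℝ) : ℂ) := by push_cast; ring
  rw [this, norm_exp_neg_I_mul]

theorem abs_g_le (p : QuadParam) (hp : p.IsNormalized) (θ : ℝ) : |p.g θ| ≤ 4 := by
  obtain ⟨hA, hB, hC⟩ := hp.norm_le
  refine (Complex.abs_im_le_norm _).trans ((norm_add₃_le).trans ?_)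
  rw [norm_mul, norm_mul, norm_mul, norm_exp_I_mul, norm_exp_neg_I_mul, norm_exp_neg_three_I_mul]
  linarith

theorem abs_hDeriv_im_le (p : QuadParam) (hp : p.IsNormalized) (θ : ℝ) :
    |(p.hDeriv θ).im| ≤ 6 := by
  obtain ⟨hA, hB, hC⟩ := hp.norm_le
  refine (Complex.abs_im_le_norm _).trans ((norm_add₃_le).trans ?_)
  rw [norm_mul, norm_mul, norm_mul, norm_mul, norm_mul, norm_mul, norm_exp_I_mul,
    norm_exp_neg_I_mul, norm_exp_neg_three_I_mul, norm_neg, norm_neg, norm_mul, Complex.norm_I,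
    RCLike.norm_ofNat]
  linarith

/-- Only the odd frequencies 1, -1, -3 occur in h. -/
theorem g_add_pi (p : QuadParam) (θ : ℝ) : p.g (θ + Real.pi) = -p.g θ := by
  have e : Complex.exp (Complex.I * ((θ + Real.pi : ℝ) : ℂ)) = -Complex.exp (Complex.I * θ) := by
    rw [Complex.ofReal_add, mul_add, Complex.exp_add, mul_comm Complex.I (Real.pi : ℂ),
      Complex.exp_pi_mul_I]
    ring
  have e3 : ∀ x : ℝ, Complex.exp (-(3 * (Complex.I * (x : ℂ))))
      = (Complex.exp (Complex.I * x))⁻¹ ^ 3 := fun x => by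
    rw [← Complex.exp_neg, ← Complex.exp_nat_mul]; congr 1; push_cast; ring
  have : p.h (θ + Real.pi) = -p.h θ := by
    simp only [h, e3, Complex.exp_neg, e]
    rw [inv_neg]
    ring
  rw [g, g, this, Complex.neg_im]

theorem exists_g_eq_zero (p : QuadParam) : ∃ a, p.g a = 0 := by
  have hc : Continuous p.g := continuous_iff_continuousAt.mpr fun t =>
    (p.hasDerivAt_g t).continuousAt
  have h1 := p.g_add_pi 0
  rw [zero_add] at h1
  rcases le_total (p.g 0) 0 with h0 | h0
  · obtain ⟨a, -, ha⟩ := intermediate_value_Icc Real.pi_pos.le hc.continuousOn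
      (show (0 : ℝ) ∈ Set.Icc (p.g 0) (p.g Real.pi) from ⟨h0, by linarith⟩)
    exact ⟨a, ha⟩
  · obtain ⟨a, -, ha⟩ := intermediate_value_Icc' Real.pi_pos.le hc.continuousOn
      (show (0 : ℝ) ∈ Set.Icc (p.g Real.pi) (p.g 0) from ⟨by linarith, h0⟩)
    exact ⟨a, ha⟩

/-- Along a tame orbit, `w = θ'` is not stationary where it is small. -/
theorem angular_accel_ne_zero (p : QuadParam) (hp : p.IsNormalized) {δ κ : ℝ} (hδ : 0 < δ)
    (hδ1 : δ < 1) (hκ : 0 < κ) (hdist : p.IsDistantFromSingular κ) {r θ : ℝ} (hr : 0 < r)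
    (ht : (r : ℂ) * Complex.exp (Complex.I * θ) ∈ p.tameDomain δ)
    (hw : |1 + r * p.g θ| ≤ 4 * (δ ^ 14 * κ / 10 ^ 10)) :
    r * (p.logVel (r * Complex.exp (Complex.I * θ))).re * p.g θ
      + r * ((p.hDeriv θ).im * (1 + r * p.g θ)) ≠ 0 := by
  set z := (r : ℂ) * Complex.exp (Complex.I * θ) with hz
  set ρ := (p.logVel z).re with hρ
  set w := 1 + r * p.g θ with hwdef
  have hnz : ‖z‖ = r := by
    rw [hz, norm_mul, norm_exp_I_mul, mul_one, Complex.norm_real, Real.norm_of_nonneg hr.le]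
  have hκ4 := hp.lt_four hdist
  have h14 : δ ^ 14 ≤ δ * δ ^ 9 := by
    rw [← pow_succ']
    exact pow_le_pow_of_le_one hδ.le hδ1.le (by norm_num)
  have h9 : δ ^ 9 ≤ 1 := pow_le_one₀ hδ.le hδ1.le
  have h90 : 0 < δ ^ 9 := by positivity
  set c := δ ^ 9 * κ / (3 * 10 ^ 7) with hc
  have hc0 : 0 < c := by positivity
  -- 4 · 10⁻¹⁰ · 3 · 10⁷ = 0.012.
  have hwδ : |w| ≤ 0.012 * (δ * c) := by
    refine hw.trans ?_
    have h1 : δ ^ 14 * κ ≤ δ * δ ^ 9 * κ := by gcongr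
    rw [hc]
    linarith
  have hc4 : c ≤ 1 / 100 := by
    have h1 : δ ^ 9 * κ ≤ 1 * 4 := by gcongr
    rw [hc]
    linarith
  have hwc : |w| ≤ 0.012 * c := by nlinarith
  have hg := p.abs_g_le hp θ
  have hr8 : 1 / 8 ≤ ‖z‖ := by
    rw [hnz]
    have h1 := (abs_le.mp hwc).2
    have h2 := (abs_le.mp hg).1
    by_contra! h3
    nlinarith
  have hε := p.le_norm_logVel hp hδ hδ1 hκ hdist ht hr8
  have him : (p.logVel z).im = w := p.logVel_polar_im hr.ne' θ
  have hnorm := Complex.norm_le_abs_re_add_abs_im (p.logVel z)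
  rw [him] at hnorm
  have hrδ : r * δ ≤ 1 := by
    have h1 := ht.1
    rwa [hnz, ← one_div, le_div_iff₀ hδ] at h1
  have hgd := p.abs_hDeriv_im_le hp θ
  intro h0
  -- Here r g = w - 1. Since |ρ| ≥ c - |w|, this makes ρ too large for the two small terms on the
  -- right.
  have e : ρ = ρ * w + r * ((p.hDeriv θ).im * w) := by linear_combination -h0
  have h1 : |ρ| ≤ |ρ| * |w| + r * (6 * |w|) := by
    conv_lhs => rw [e]
    refine (abs_add_le _ _).trans ?_
    rw [abs_mul, abs_mul, abs_mul, abs_of_pos hr]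
    gcongr
  have h2 : r * (6 * |w|) ≤ 0.072 * c := by
    calc r * (6 * |w|) ≤ r * (6 * (0.012 * (δ * c))) := by gcongr
      _ = 0.072 * (r * δ) * c := by ring
      _ ≤ 0.072 * 1 * c := by gcongr
      _ = 0.072 * c := by ring
  have h3 : |ρ| * |w| ≤ |ρ| * 0.1 := by gcongr; linarith
  linarith

end QuadParam

/-! ### Lifting the orbit to polar coordinates, and the main theorem. -/

/-- A curve in `ℂ` that avoids the origin has a differentiable logarithm. -/
theorem exists_log_lift {γ v : ℝ → ℂ} (hv : Continuous v) (hγ : ∀ t, HasDerivAt γ (v t) t)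
    (h0 : ∀ t, γ t ≠ 0) :
    ∃ l : ℝ → ℂ, (∀ t, γ t = Complex.exp (l t)) ∧ ∀ t, HasDerivAt l (v t / γ t) t := by
  have hc : Continuous γ := continuous_iff_continuousAt.mpr fun t => (hγ t).continuousAt
  have hE : Continuous fun t => v t / γ t := hv.div hc h0
  have hl : ∀ t, HasDerivAt (fun u => Complex.log (γ 0) + ∫ x in (0 : ℝ)..u, v x / γ x)
      (v t / γ t) t := fun t => ((hE.integral_hasStrictDerivAt 0 t).hasDerivAt).const_add _
  refine ⟨_, fun t => ?_, hl⟩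
  set l := fun u => Complex.log (γ 0) + ∫ x in (0 : ℝ)..u, v x / γ x with hldef
  have hd : ∀ t, HasDerivAt (fun u => γ u * Complex.exp (-l u)) 0 t := by
    intro t
    have h1 := (hγ t).mul (hl t).neg.cexp
    have h2 : v t * Complex.exp (-l t) + γ t * (Complex.exp (-l t) * -(v t / γ t)) = 0 := by
      have := h0 t
      field_simp
      ring
    rwa [← h2]
  have h1 := is_const_of_deriv_eq_zero (fun t => (hd t).differentiableAt)
    (fun t => (hd t).deriv) t 0
  have h2 : l 0 = Complex.log (γ 0) := by simp [hldef]
  have h3 : γ t * Complex.exp (-l t) = 1 := by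
    rw [h1, h2, Complex.exp_neg, Complex.exp_log (h0 0), mul_inv_cancel₀ (h0 0)]
  rw [Complex.exp_neg] at h3
  field_simp at h3
  exact h3

/-- A set that surrounds the origin meets every ray. -/
theorem Surrounds.exists_mem_ray {L : Set ℂ} (hL : Surrounds L 0) (a : ℝ) :
    ∃ s : ℝ, 0 < s ∧ (s : ℂ) * Complex.exp (Complex.I * a) ∈ L := by
  by_contra! hno
  set ray : ℝ → ℂ := fun s => (s : ℂ) * Complex.exp (Complex.I * a) with hray
  have hc : Continuous ray := by fun_prop
  have hsub : ray '' Set.Ici 0 ⊆ Lᶜ := by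
    rintro _ ⟨s, hs, rfl⟩ hsL
    rcases (Set.mem_Ici.mp hs).eq_or_lt with rfl | hs
    · exact hL.1 (by simpa [hray] using hsL)
    · exact hno s hs hsL
  -- A ray from 0 that misses L would lie in the component of 0, which is bounded.
  have hconn : IsPreconnected (ray '' Set.Ici 0) :=
    (convex_Ici (0 : ℝ)).isPreconnected.image ray hc.continuousOn
  have hbd := hL.2.subset (hconn.subset_connectedComponentIn
    ⟨0, Set.self_mem_Ici, by simp [hray]⟩ hsub)
  obtain ⟨M, hM⟩ := hbd.exists_norm_le
  have h1 := hM (ray (|M| + 1)) ⟨_, Set.mem_Ici.mpr (by positivity), rfl⟩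
  rw [hray, norm_mul, QuadParam.norm_exp_I_mul, mul_one, Complex.norm_real,
    Real.norm_of_nonneg (by positivity)] at h1
  linarith [le_abs_self M]

/-- Two coincident points of a bounded integral curve differ by a period. -/
theorem eq_shift_of_eq {v : ℂ → ℂ} (hv : ContDiff ℝ 1 v) {γ : ℝ → ℂ}
    (hγ : ∀ t, HasDerivAt γ (v (γ t)) t) {R : ℝ} (hR : ∀ t, ‖γ t‖ ≤ R) {τ s : ℝ}
    (hs : γ (s + τ) = γ s) (t : ℝ) : γ (t + τ) = γ t := by
  -- The field is only locally Lipschitz; boundedness of the orbit provides a compact convex set for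
  -- uniqueness.
  obtain ⟨K, hK⟩ := hv.contDiffOn.exists_lipschitzOnWith one_ne_zero
    (convex_closedBall (0 : ℂ) R) (isCompact_closedBall 0 R)
  have hmem : ∀ t, γ t ∈ Metric.closedBall (0 : ℂ) R := fun t => by simpa using hR t
  have := ODE_solution_unique_univ (v := fun _ => v) (s := fun _ => Metric.closedBall (0 : ℂ) R)
    (f := fun t => γ (t + τ)) (g := γ) (t₀ := s) (fun _ => hK)
    (fun t => ⟨(hγ (t + τ)).comp_add_const t τ, hmem _⟩) (fun t => ⟨hγ t, hmem t⟩) hs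
  exact congrFun this t

theorem mainTheorem4 (p : QuadParam) (hp : p.IsNormalized) (δ κ : ℝ)
    (hδ : 0 < δ) (hδ1 : δ < 1) (hκ : 0 < κ) (hdist : p.IsDistantFromSingular κ)
    (L : Set ℂ) (hL : IsTameLimitCycle p δ L) (h0 : Surrounds L 0) :
    Disjoint L (p.strip δ (δ ^ 14 * κ / 10 ^ 10)) := by
  obtain ⟨⟨⟨γ, T, hT, hγ, hper, -, rfl⟩, -⟩, htame⟩ := hL
  have hγt : ∀ t, γ t ∈ p.tameDomain δ := fun t => htame ⟨t, rfl⟩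
  have hγ0 : ∀ t, γ t ≠ 0 := fun t h => h0.1 ⟨t, h⟩
  have hγc : Continuous γ := continuous_iff_continuousAt.mpr fun t => (hγ t).continuousAt
  obtain ⟨l, hl, hld⟩ := exists_log_lift (p.contDiff_field.continuous.comp hγc) hγ hγ0
  set θ : ℝ → ℝ := fun t => (l t).im with hθdef
  set r : ℝ → ℝ := fun t => Real.exp (l t).re with hrdef
  have hr0 : ∀ t, 0 < r t := fun t => Real.exp_pos _
  have hpol : ∀ t, γ t = (r t : ℂ) * Complex.exp (Complex.I * θ t) := by
    intro t
    rw [hl t, hrdef, Complex.ofReal_exp, ← Complex.exp_add]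
    congr 1
    rw [mul_comm, Complex.re_add_im]
  have hw : ∀ t, (p.logVel (γ t)).im = 1 + r t * p.g (θ t) := fun t => by
    rw [hpol t, p.logVel_polar_im (hr0 t).ne']
  have hθ : ∀ t, HasDerivAt θ (1 + r t * p.g (θ t)) t := by
    intro t
    rw [← hw t]
    exact (Complex.imCLM.hasFDerivAt.comp_hasDerivAt t (hld t) :)
  have hr : ∀ t, HasDerivAt r (r t * (p.logVel (γ t)).re) t := by
    intro t
    have h1 : HasDerivAt (fun t => (l t).re) (p.logVel (γ t)).re t :=
      (Complex.reCLM.hasFDerivAt.comp_hasDerivAt t (hld t) :)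
    exact h1.exp
  have hθc : Continuous θ := continuous_iff_continuousAt.mpr fun t => (hθ t).continuousAt
  have hrc : Continuous r := continuous_iff_continuousAt.mpr fun t => (hr t).continuousAt
  set w' : ℝ → ℝ := fun t => r t * (p.logVel (γ t)).re * p.g (θ t)
    + r t * ((p.hDeriv (θ t)).im * (1 + r t * p.g (θ t))) with hw'def
  have hwd : ∀ t, HasDerivAt (fun t => 1 + r t * p.g (θ t)) (w' t) t := fun t =>
    ((hr t).mul ((p.hasDerivAt_g (θ t)).comp t (hθ t))).const_add 1
  have hreg : ∀ t, |1 + r t * p.g (θ t)| ≤ 4 * (δ ^ 14 * κ / 10 ^ 10) → w' t ≠ 0 := by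
    intro t ht
    have h1 := hγt t
    rw [hpol t] at h1
    have h2 := p.angular_accel_ne_zero hp hδ hδ1 hκ hdist (hr0 t) h1 ht
    rwa [← hpol t] at h2
  have hshift : ∀ τ, (∀ t, γ (t + τ) = γ t) → ∀ s t, θ (t + τ) - θ t = θ (s + τ) - θ s := by
    intro τ hτ s t
    have hd : ∀ t, HasDerivAt (fun t => l (t + τ) - l t) 0 t := by
      intro t
      have h1 := ((hld (t + τ)).comp_add_const t τ).sub (hld t)
      simp only [Function.comp_apply, hτ t, sub_self] at h1
      exact h1
    have h1 := is_const_of_deriv_eq_zero (fun t => (hd t).differentiableAt)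
      (fun t => (hd t).deriv) t s
    have h2 := congrArg Complex.im h1
    simpa using h2
  -- an angle at which the orbit turns with unit speed
  obtain ⟨a, ha⟩ := p.exists_g_eq_zero
  obtain ⟨s, hs, ta, hta⟩ := h0.exists_mem_ray a
  have hga : p.g (θ ta) = 0 := by
    have h1 := hw ta
    rw [hta, p.logVel_polar_im hs.ne', ha, mul_zero] at h1
    have h2 : r ta * p.g (θ ta) = 0 := by linarith
    exact (mul_eq_zero.mp h2).resolve_left (hr0 ta).ne'
  -- The level θ ta is crossed only with θ' = 1, hence upwards and just once.
  have hret : ∀ t, ta < t → θ ta < θ t := fun t ht =>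
    lt_of_hasDerivAt_pos_on_level hθ (fun t h => by rw [h, hga]; norm_num) le_rfl ht
  set P := θ (ta + T) - θ ta with hP
  have hP0 : 0 < P := sub_pos.mpr (hret _ (by linarith))
  have hθn : ∀ (n : ℕ) t, θ (t + n * T) = θ t + n * P := by
    intro n
    induction n with
    | zero => simp
    | succ n ih =>
      intro t
      have h1 := hshift T hper ta (t + n * T)
      have h2 : t + ((n + 1 : ℕ) : ℝ) * T = t + n * T + T := by push_cast; ring
      rw [h2]
      have h3 := ih t
      push_cast
      linarith
  have hunb : ∀ s M, ∃ t, s < t ∧ M ≤ θ t := by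
    intro s M
    obtain ⟨n, hn⟩ := exists_nat_gt ((M - θ s) / P)
    rw [div_lt_iff₀ hP0] at hn
    refine ⟨s + (n + 1 : ℕ) * T, ?_, ?_⟩
    · have : 0 < ((n + 1 : ℕ) : ℝ) * T := by positivity
      linarith
    · rw [hθn]
      push_cast
      linarith
  have hbdd : ∀ t, ‖γ t‖ ≤ δ⁻¹ := fun t => (hγt t).1
  -- A coincidence in lifted coordinates would make the lifted angle periodic, hence bounded.
  have hinj : ∀ s t, θ s = θ t → r s = r t → s = t := by
    intro s t h1 h2
    by_contra hne
    have hγst : γ (s + (t - s)) = γ s := by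
      rw [add_sub_cancel, hpol s, hpol t, h1, h2]
    have hp' := eq_shift_of_eq p.contDiff_field hγ hbdd hγst
    have hθper : Function.Periodic θ (t - s) := by
      intro x
      have h3 := hshift _ hp' s x
      rw [add_sub_cancel, ← h1, sub_self] at h3
      linarith
    obtain ⟨M, hM⟩ := (hθper.compact_of_continuous
      (sub_ne_zero.mpr (Ne.symm hne)) hθc).bddAbove
    obtain ⟨y, -, hy⟩ := hunb 0 (M + 1)
    have := hM ⟨y, rfl⟩
    linarith
  have hβ0 : 0 < δ ^ 14 * κ / 10 ^ 10 := by positivity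
  have hwper : Function.Periodic (fun t => 1 + r t * p.g (θ t)) T := fun t => by
    change 1 + r (t + T) * p.g (θ (t + T)) = 1 + r t * p.g (θ t)
    rw [← hw, ← hw, hper]
  -- The trap argument covers times from ta on; periodicity of w carries it back to all times.
  have hpos : ∀ t, 0 < 1 + r t * p.g (θ t) := by
    intro t
    obtain ⟨n, hn⟩ := exists_nat_gt ((ta - t) / T)
    rw [div_lt_iff₀ hT] at hn
    have h1 : 0 < 1 + r (t + n * T) * p.g (θ (t + n * T)) :=
      polar_angle_deriv_pos hθ hwd hrc hr0 hinj
        (fun t ht => hreg t (by rw [ht, abs_zero]; positivity))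
        (by rw [hga]; norm_num) hret hunb (by linarith)
    have h2 := hwper.nat_mul n t
    change 1 + r (t + n * T) * p.g (θ (t + n * T)) = 1 + r t * p.g (θ t) at h2
    rwa [h2] at h1
  rw [Set.disjoint_left]
  rintro _ ⟨t, rfl⟩ ⟨-, q, φ, hq, hz, hg, hlow, hupp⟩
  have hq0 : 0 < q := lt_of_le_of_ne hq fun h => hγ0 t (by rw [hz, ← h]; simp)
  have hgneg : p.g φ < 0 := by
    have h1 : 0 < -1 / p.g φ := hq0.trans_le hupp
    by_contra! h2
    exact absurd h1 (not_lt.mpr (div_nonpos_of_nonpos_of_nonneg (by norm_num) h2))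
  -- From r ≥ -1/g - β one gets 1 + r g ≤ -β g, and |g| ≤ 4.
  have hwt : 1 + r t * p.g (θ t) ≤ 4 * (δ ^ 14 * κ / 10 ^ 10) := by
    rw [← hw t, hz, p.logVel_polar_im hq0.ne']
    have h1 := mul_le_mul_of_nonpos_right hlow hgneg.le
    rw [sub_mul, div_mul_cancel₀ _ hg] at h1
    have h2 := (abs_le.mp (p.abs_g_le hp φ)).1
    nlinarith
  obtain ⟨_, ⟨⟨m, rfl⟩, hm⟩⟩ := (hwper.compact_of_continuous hT.ne'
    (continuous_iff_continuousAt.mpr fun t => (hwd t).continuousAt)).exists_isLeast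
    (Set.range_nonempty _)
  have hmin : ∀ t, 1 + r m * p.g (θ m) ≤ 1 + r t * p.g (θ t) := fun t => hm ⟨t, rfl⟩
  have hloc : IsLocalMin (fun t => 1 + r t * p.g (θ t)) m := Filter.Eventually.of_forall hmin
  refine hreg m ?_ (hloc.hasDerivAt_eq_zero (hwd m))
  rw [abs_of_pos (hpos m)]
  exact (hmin t).trans hwt
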